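/- Work in max algebra: $\mathbb{R}_+=[0,\infty)$ with $a\oplus b=\max(a,b)$ and ordinary multiplication, and the induced product $A\otimes x$. Let $A\in\mathbb{R}_+^{n\times n}$, $\lambda>0$, $N=\{1,\dots,n\}$, $V(A,\lambda)=\{x\in\mathbb{R}_+^n: A\otimes x=\lambda x\}$. For a matrix $B$ let $\mathrm{span}(B)$ be its max-algebraic column span, $B^{(i)}$ the matrix $B$ with its $i$-th column removed, and $P_B(x)=\max\{y\in\mathrm{span}(B): y\le x\}$. Let $N^\lambda$ be the union of the supports of all vectors of $V(A,\lambda)$. The critical graph $\mathcal{C}(A,\lambda)$ consists of the nodes (forming the set $N_c(A,\lambda)$) and edges of all cycles of geometric mean $\lambda$ in the digraph of $A$ (with an edge $(i,j)$ when $a_{ij}>0$) restricted to $N^\lambda$. Let $A_\lambda$ have columns $A_{\cdot j}/\lambda$ for $j\in N^\lambda$ and $0$ otherwise, $A_\lambda^+=\bigoplus_{m\ge1}A_\lambda^{\otimes m}$, and let $G_{A,\lambda}=[(A_\lambda^+)_{\cdot j_1},\dots,(A_\lambda^+)_{\cdot j_k}]$, where $j_1,\dots,j_k$ are the first indices in the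 strongly connected components of $\mathcal{C}(A,\lambda)$. Let $\mathbf{X}=\mathbf{X}_1\times\dots\times\mathbf{X}_n$, where each $\mathbf{X}_i\subseteq\mathbb{R}_+$ is an interval, possibly unbounded, and $\underline{x}_i=\inf\mathbf{X}_i$, $\overline{x}_i=\sup\mathbf{X}_i$. Suppose that $\mathbf{X}$ is $\underline{x}$-open, i.e. $\underline{x}_i\notin\mathbf{X}_i$ for all $i$, and that $V(A,\lambda)\cap\mathbf{X}\ne\emptyset$. Say that $A$ has $\mathbf{X}$-simple image eigencone if every nonzero $x\in V(A,\lambda)\cap\mathbf{X}$ is the unique solution $y\in\mathbf{X}$ of $A\otimes y=\lambda x$. Then: (i) $A$ has $\mathbf{X}$-simple image eigencone (corresponding to $\lambda$) if and only if $$\mathrm{span}(A^{(i)})\cap V(A,\lambda)\cap\mathbf{X}=\emptyset\quad\text{for all } i=1,\dots,n.\qquad(1)$$ (ii) In that case $N_c(A,\lambda)=N$ and $\mathcal{C}(A,\lambda)$ consists of pairwise disjoint cycles $c_1,\dots,c_k$, one for each of its strongly connected components. (iii) If $N_c(A,\lambda)=N$ and $\mathcal{C}(A,\lambda)$ consists of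 disjoint cycles $c_1,\dots,c_k$ as in (ii), then (1) is equivalent to $\mathrm{span}(G_{A,\lambda}^{(s)})\cap\mathbf{X}=\emptyset$ for all $s=1,\dots,k$. (iv) If, in the situation of (iii), $\mathbf{X}$ is also $\overline{x}$-closed (i.e. $\overline{x}$ is finite and $\overline{x}\in\mathbf{X}$), then (1) is also equivalent to: for every $s=1,\dots,k$, it is not the case that $\bigl(P_{G_{A,\lambda}^{(s)}}\overline{x}\bigr)_i>\underline{x}_i$ for all $i$. -/

import Mathlib

open scoped NNReal

namespace MaxAlg

noncomputable section

/-! Max algebra: the semiring of nonnegative reals with `a ⊕ b = max a b` and `a ⊗ b = a * b`.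
A max-algebraic sum over a finite index set is `Finset.sup` (the empty sum is `⊥ = 0`). -/

/-- The max-algebraic matrix-vector product `A ⊗ x`. -/
def mulVec {m ι : Type*} [Fintype ι] (A : Matrix m ι ℝ≥0) (x : ι → ℝ≥0) : m → ℝ≥0 :=
  fun i => Finset.univ.sup fun j => A i j * x j

/-- The max-algebraic matrix product `A ⊗ B`. -/
def mul {m ι κ : Type*} [Fintype ι] (A : Matrix m ι ℝ≥0) (B : Matrix ι κ ℝ≥0) :
    Matrix m κ ℝ≥0 :=
  fun i j => Finset.univ.sup fun l => A i l * B l j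

/-- The max-algebraic column span of `A`. -/
def colSpan {m ι : Type*} [Fintype ι] (A : Matrix m ι ℝ≥0) : Set (m → ℝ≥0) :=
  {y | ∃ x : ι → ℝ≥0, y = mulVec A x}

/-- The matrix `A^{(i)}` obtained from `A` by removing its `i`-th column. -/
def deleteCol {m ι : Type*} (A : Matrix m ι ℝ≥0) (i : ι) : Matrix m {j : ι // j ≠ i} ℝ≥0 :=
  fun l j => A l j.1

/-- The projector `P_W x = max {y ∈ W | y ≤ x}`, written as a coordinatewise supremum.
When `W` is a column span this supremum is a maximum, see `isGreatest_proj_colSpan`. -/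
def proj {m : Type*} (W : Set (m → ℝ≥0)) (x : m → ℝ≥0) : m → ℝ≥0 :=
  fun i => sSup ((fun y => y i) '' {y | y ∈ W ∧ y ≤ x})

theorem proj_eq_of_isGreatest {m : Type*} {W : Set (m → ℝ≥0)} {x p : m → ℝ≥0}
    (h : IsGreatest {y | y ∈ W ∧ y ≤ x} p) : proj W x = p := by
  funext i
  refine IsGreatest.csSup_eq ⟨⟨p, h.1, rfl⟩, ?_⟩
  rintro _ ⟨y, hy, rfl⟩
  exact h.2 hy i

theorem exists_isGreatest_colSpan {m ι : Type*} [Finite m] [Fintype ι] (A : Matrix m ι ℝ≥0)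
    (x : m → ℝ≥0) : ∃ p, IsGreatest {y | y ∈ colSpan A ∧ y ≤ x} p := by
  have key : ∀ j : ι, ∃ g : ℝ≥0, (∀ i, A i j * g ≤ x i) ∧
      ∀ c : ℝ≥0, (∀ i, A i j * c ≤ x i) → ∀ i, A i j * c ≤ A i j * g := by
    intro j
    by_cases hj : ∃ i, A i j ≠ 0
    · obtain ⟨i₀, hi₀⟩ := hj
      have : Nonempty {i : m // A i j ≠ 0} := ⟨⟨i₀, hi₀⟩⟩
      obtain ⟨⟨k, hk⟩, hmin⟩ :=
        Finite.exists_min (fun i : {i : m // A i j ≠ 0} => x i.1 / A i.1 j)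
      refine ⟨x k / A k j, fun i => ?_, fun c hc i => ?_⟩
      · by_cases hi : A i j = 0
        · simp [hi]
        · have h1 := hmin ⟨i, hi⟩
          calc A i j * (x k / A k j) ≤ A i j * (x i / A i j) := by gcongr
            _ = x i := mul_div_cancel₀ _ hi
      · apply mul_le_mul_right
        rw [le_div_iff₀ (pos_iff_ne_zero.2 hk), mul_comm]
        exact hc k
    · push Not at hj
      exact ⟨0, fun i => by simp, fun c _ i => by simp [hj i]⟩
  choose g hg1 hg2 using key
  refine ⟨mulVec A g, ⟨⟨g, rfl⟩, fun i => Finset.sup_le fun j _ => hg1 j i⟩, ?_⟩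
  rintro _ ⟨⟨c, rfl⟩, hy⟩ i
  refine Finset.sup_mono_fun fun j _ => hg2 j (c j) (fun l => ?_) i
  exact (Finset.le_sup (f := fun j => A l j * c j) (Finset.mem_univ j)).trans (hy l)

/-- On a column span the projector is the maximum of `{y ∈ span A | y ≤ x}`. -/
theorem isGreatest_proj_colSpan {m ι : Type*} [Finite m] [Fintype ι] (A : Matrix m ι ℝ≥0)
    (x : m → ℝ≥0) : IsGreatest {y | y ∈ colSpan A ∧ y ≤ x} (proj (colSpan A) x) := by
  obtain ⟨p, hp⟩ := exists_isGreatest_colSpan A x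
  rwa [proj_eq_of_isGreatest hp]

/-- The eigencone `V(A, μ) = {x | A ⊗ x = μ x}`. -/
def eigencone {n : ℕ} (A : Matrix (Fin n) (Fin n) ℝ≥0) (μ : ℝ≥0) : Set (Fin n → ℝ≥0) :=
  {x | mulVec A x = μ • x}

/-- The set `N^μ`: the largest support of a vector of `V(A, μ)`, i.e. the union of the supports
of these vectors (it is itself such a support, see `exists_support_eq_maxSupport`). -/
def maxSupport {n : ℕ} (A : Matrix (Fin n) (Fin n) ℝ≥0) (μ : ℝ≥0) : Set (Fin n) :=
  {i | ∃ x ∈ eigencone A μ, i ∈ Function.support x}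

theorem zero_mem_eigencone {n : ℕ} (A : Matrix (Fin n) (Fin n) ℝ≥0) (μ : ℝ≥0) :
    (0 : Fin n → ℝ≥0) ∈ eigencone A μ := by
  funext i
  simp [mulVec]

theorem sup_mem_eigencone {n : ℕ} {A : Matrix (Fin n) (Fin n) ℝ≥0} {μ : ℝ≥0}
    {x y : Fin n → ℝ≥0} (hx : x ∈ eigencone A μ) (hy : y ∈ eigencone A μ) :
    x ⊔ y ∈ eigencone A μ := by
  funext i
  have h1 := congrFun hx i
  have h2 := congrFun hy i
  simp only [mulVec, Pi.smul_apply, smul_eq_mul, Pi.sup_apply] at h1 h2 ⊢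
  simp only [NNReal.mul_sup, ← h1, ← h2]
  exact Finset.sup_sup

/-- Some `x' ∈ V(A, μ)` has support `N^μ`; this support contains that of every vector of
`V(A, μ)` by definition of `N^μ`. -/
theorem exists_support_eq_maxSupport {n : ℕ} (A : Matrix (Fin n) (Fin n) ℝ≥0) (μ : ℝ≥0) :
    ∃ x ∈ eigencone A μ, Function.support x = maxSupport A μ := by
  classical
  have h : ∀ i, ∃ x ∈ eigencone A μ, i ∈ maxSupport A μ → x i ≠ 0 := by
    intro i
    by_cases hi : i ∈ maxSupport A μ
    · obtain ⟨x, hx, hxi⟩ := hi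
      exact ⟨x, hx, fun _ => hxi⟩
    · exact ⟨0, zero_mem_eigencone A μ, fun h => absurd h hi⟩
  choose f hf hf' using h
  have hmem : Finset.univ.sup f ∈ eigencone A μ :=
    Finset.sup_induction (p := fun x => x ∈ eigencone A μ) (zero_mem_eigencone A μ)
      (fun _ h1 _ h2 => sup_mem_eigencone h1 h2) (fun i _ => hf i)
  refine ⟨_, hmem, Set.Subset.antisymm (fun i hi => ⟨_, hmem, hi⟩) fun i hi => ?_⟩
  have h1 : f i i ≤ (Finset.univ.sup f) i := Finset.le_sup (f := f) (Finset.mem_univ i) i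
  exact (lt_of_lt_of_le (pos_iff_ne_zero.2 (hf' i hi)) h1).ne'

/-- A cyclic sequence `(i_0, …, i_k)` of distinct nodes; its edges are
`(i_0, i_1), …, (i_{k-1}, i_k), (i_k, i_0)` (addition in `Fin (k + 1)` is modulo `k + 1`),
so that `k = 0` is a loop. -/
structure NodeCycle (n : ℕ) where
  /-- the number of nodes minus one -/
  k : ℕ
  /-- the nodes, in cyclic order -/
  node : Fin (k + 1) → Fin n
  /-- the nodes are distinct -/
  node_injective : Function.Injective node

/-- The node set of a cycle. -/
def NodeCycle.nodes {n : ℕ} (c : NodeCycle n) : Set (Fin n) := Set.range c.node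

/-- `(i, j)` is an edge of the cycle. -/
def NodeCycle.IsEdge {n : ℕ} (c : NodeCycle n) (i j : Fin n) : Prop :=
  ∃ t : Fin (c.k + 1), c.node t = i ∧ c.node (t + 1) = j

/-- The geometric mean of the weights of the edges of a cycle. -/
def NodeCycle.geomMean {n : ℕ} (A : Matrix (Fin n) (Fin n) ℝ≥0) (c : NodeCycle n) : ℝ≥0 :=
  (∏ t : Fin (c.k + 1), A (c.node t) (c.node (t + 1))) ^ (1 / ((c.k : ℝ) + 1))

/-- `c` is a critical cycle for `μ`: a cycle of the digraph of `A` (edges are the pairs with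
nonzero entry) restricted to `N^μ`, with geometric mean `μ`. -/
def IsCriticalCycle {n : ℕ} (A : Matrix (Fin n) (Fin n) ℝ≥0) (μ : ℝ≥0) (c : NodeCycle n) :
    Prop :=
  c.nodes ⊆ maxSupport A μ ∧ (∀ i j, c.IsEdge i j → 0 < A i j) ∧ c.geomMean A = μ

/-- The set `N_c(A, μ)` of nodes of the critical graph. -/
def critNodes {n : ℕ} (A : Matrix (Fin n) (Fin n) ℝ≥0) (μ : ℝ≥0) : Set (Fin n) :=
  {i | ∃ c, IsCriticalCycle A μ c ∧ i ∈ c.nodes}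

/-- `(i, j)` is an edge of the critical graph. -/
def CritEdge {n : ℕ} (A : Matrix (Fin n) (Fin n) ℝ≥0) (μ : ℝ≥0) (i j : Fin n) : Prop :=
  ∃ c, IsCriticalCycle A μ c ∧ c.IsEdge i j

/-- `i` and `j` lie in the same strongly connected component of the critical graph
(for critical nodes). -/
def SameCritComponent {n : ℕ} (A : Matrix (Fin n) (Fin n) ℝ≥0) (μ : ℝ≥0) (i j : Fin n) :
    Prop :=
  Relation.ReflTransGen (CritEdge A μ) i j ∧ Relation.ReflTransGen (CritEdge A μ) j i

open Classical in
/-- The first indices `j_1, …, j_k` of the strongly connected components of the critical graph.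
They label these components. -/
def critReps {n : ℕ} (A : Matrix (Fin n) (Fin n) ℝ≥0) (μ : ℝ≥0) : Finset (Fin n) :=
  Finset.univ.filter fun j => j ∈ critNodes A μ ∧ ∀ i, SameCritComponent A μ i j → j ≤ i

/-- The critical graph is the union of pairwise disjoint cycles `c_s`, one for each of its
strongly connected components. -/
def CritIsDisjointCycles {n : ℕ} (A : Matrix (Fin n) (Fin n) ℝ≥0) (μ : ℝ≥0) : Prop :=
  ∃ c : critReps A μ → NodeCycle n,
    (∀ s, s.1 ∈ (c s).nodes) ∧
    (∀ s t, s ≠ t → Disjoint (c s).nodes (c t).nodes) ∧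
    (∀ i, i ∈ critNodes A μ ↔ ∃ s, i ∈ (c s).nodes) ∧
    (∀ i j, CritEdge A μ i j ↔ ∃ s, (c s).IsEdge i j)

open Classical in
/-- The matrix `A_μ`: column `j` is `A_{·j} / μ` if `j ∈ N^μ`, and zero otherwise. -/
def normalized {n : ℕ} (A : Matrix (Fin n) (Fin n) ℝ≥0) (μ : ℝ≥0) :
    Matrix (Fin n) (Fin n) ℝ≥0 :=
  fun i j => if j ∈ maxSupport A μ then A i j / μ else 0

/-- `powSucc A k` is the max-algebraic power `A^{⊗ (k + 1)}`. -/
def powSucc {n : ℕ} (A : Matrix (Fin n) (Fin n) ℝ≥0) : ℕ → Matrix (Fin n) (Fin n) ℝ≥0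
  | 0 => A
  | k + 1 => mul A (powSucc A k)

/-- The series `A^+ = A ⊕ A^{⊗ 2} ⊕ A^{⊗ 3} ⊕ ⋯`; it is used only where it is finite, see
`bddAbove_powSucc_normalized`. -/
def plus {n : ℕ} (A : Matrix (Fin n) (Fin n) ℝ≥0) : Matrix (Fin n) (Fin n) ℝ≥0 :=
  fun i j => ⨆ k : ℕ, powSucc A k i j

/-- The series `(A_μ)^+` is finite for `μ > 0`. -/
theorem bddAbove_powSucc_normalized {n : ℕ} (A : Matrix (Fin n) (Fin n) ℝ≥0) {μ : ℝ≥0}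
    (hμ : 0 < μ) (i j : Fin n) :
    BddAbove (Set.range fun k : ℕ => powSucc (normalized A μ) k i j) := by
  obtain ⟨x, hx, hsupp⟩ := exists_support_eq_maxSupport A μ
  have hstep : ∀ i l, normalized A μ i l * x l ≤ x i := by
    intro i l
    unfold normalized
    split_ifs with hl
    · have h1 : A i l * x l ≤ μ * x i := by
        have h2 := congrFun hx i
        simp only [mulVec, Pi.smul_apply, smul_eq_mul] at h2
        rw [← h2]
        exact Finset.le_sup (f := fun j => A i j * x j) (Finset.mem_univ l)
      rw [div_mul_eq_mul_div, div_le_iff₀ hμ, mul_comm (x i)]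
      exact h1
    · simp
  have hpow : ∀ k i, powSucc (normalized A μ) k i j * x j ≤ x i := by
    intro k
    induction k with
    | zero => exact fun i => hstep i j
    | succ k ih =>
      intro i
      simp only [powSucc, mul, NNReal.finset_sup_mul]
      refine Finset.sup_le fun l _ => ?_
      rw [mul_assoc]
      exact (mul_le_mul_right (ih l) _).trans (hstep i l)
  by_cases hj : j ∈ maxSupport A μ
  · have hxj : 0 < x j := pos_iff_ne_zero.2 (by rw [← hsupp] at hj; exact hj)
    refine ⟨x i / x j, ?_⟩
    rintro _ ⟨k, rfl⟩
    exact (le_div_iff₀ hxj).2 (hpow k i)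
  · have hz : ∀ k i, powSucc (normalized A μ) k i j = 0 := by
      intro k
      induction k with
      | zero => intro i; simp [powSucc, normalized, hj]
      | succ k ih => intro i; simp [powSucc, mul, ih]
    refine ⟨0, ?_⟩
    rintro _ ⟨k, rfl⟩
    exact (hz k i).le

/-- The generating matrix `G_{A, μ}`, whose columns are the columns `j_1, …, j_k` of
`(A_μ)^+`. -/
def generating {n : ℕ} (A : Matrix (Fin n) (Fin n) ℝ≥0) (μ : ℝ≥0) :
    Matrix (Fin n) (critReps A μ) ℝ≥0 :=
  fun i s => plus (normalized A μ) i s.1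

/-- The box `X_1 × ⋯ × X_n`. -/
def box {n : ℕ} (X : Fin n → Set ℝ≥0) : Set (Fin n → ℝ≥0) := {x | ∀ i, x i ∈ X i}

/-- The vector of the infima of the `X_i`. -/
def lower {n : ℕ} (X : Fin n → Set ℝ≥0) : Fin n → ℝ≥0 := fun i => sInf (X i)

/-- The vector of the suprema of the `X_i` (meaningful when they are bounded above). -/
def upper {n : ℕ} (X : Fin n → Set ℝ≥0) : Fin n → ℝ≥0 := fun i => sSup (X i)

/-- No infimum of an `X_i` belongs to `X_i`. -/
def LowerOpen {n : ℕ} (X : Fin n → Set ℝ≥0) : Prop := ∀ i, lower X i ∉ X i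

/-- The vector of the suprema is finite and belongs to the box. -/
def UpperClosed {n : ℕ} (X : Fin n → Set ℝ≥0) : Prop :=
  (∀ i, BddAbove (X i)) ∧ upper X ∈ box X

/-- `A` has `X`-simple image eigencone associated with `μ`: every eigenvector `x ∈ X` associated
with `μ` is the unique solution `y ∈ X` of `A ⊗ y = μ x`. -/
def HasSimpleImageEigencone {n : ℕ} (A : Matrix (Fin n) (Fin n) ℝ≥0) (μ : ℝ≥0)
    (X : Set (Fin n → ℝ≥0)) : Prop :=
  ∀ x ∈ eigencone A μ, x ≠ 0 → x ∈ X → ∀ y ∈ X, mulVec A y = μ • x → y = x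

end

end MaxAlg

namespace MaxAlg

/-! ### Boxes -/

/-! Since the box omits its lower ends, its vectors are positive and any single coordinate can be
decreased inside the box. Everything is read off from the tight edges of an eigenvector `x` in the
box.

For (i), if `x` lies in the span of `A` without a column, then for some `l` every row is tight
outside column `l`; lowering `x l` gives a second solution. Conversely, if two solutions differ at
`i`, the smaller one never attains the maximum through column `i`, so that column can be spared.

For (ii), (1) forces each column to be the only tight one in some row, so by counting the tight
edges form a permutation (`exists_bijective_tight_iff`). Multiplying the eigenvector inequalities
around a cycle shows that critical cycles are exactly cycles of tight edges (`isCriticalCycle_iff`),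
so the critical graph is that permutation.

For (iii), once the critical graph is a permutation, a noncritical tight edge must leave its
component. If one exists, that component's generator is redundant for `x`, because tight paths lead
on to another component (`exists_mem_colSpan_deleteCol_generating`). If none leaves a component, `x`
can be shrunk there and remain a subeigenvector, which rules out generation by the other columns
(`colSpan_deleteCol_generating_eq_empty`). Part (iv) tests the box on the greatest element of the
span below its upper corner. -/

theorem lower_lt {n : ℕ} {X : Fin n → Set ℝ≥0} (hopen : LowerOpen X) {x : Fin n → ℝ≥0}
    (hx : x ∈ box X) (i : Fin n) : lower X i < x i :=
  lt_of_le_of_ne (csInf_le (OrderBot.bddBelow _) (hx i)) fun h => hopen i (h ▸ hx i)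

theorem pos_of_mem_box {n : ℕ} {X : Fin n → Set ℝ≥0} (hopen : LowerOpen X) {x : Fin n → ℝ≥0}
    (hx : x ∈ box X) (i : Fin n) : 0 < x i :=
  zero_le.trans_lt (lower_lt hopen hx i)

theorem exists_update_mem_box {n : ℕ} {X : Fin n → Set ℝ≥0} (hopen : LowerOpen X)
    {x : Fin n → ℝ≥0} (hx : x ∈ box X) (i : Fin n) :
    ∃ t < x i, Function.update x i t ∈ box X := by
  obtain ⟨t, ht, htx⟩ := exists_lt_of_csInf_lt ⟨_, hx i⟩ (lower_lt hopen hx i)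
  refine ⟨t, htx, fun j => ?_⟩
  rcases eq_or_ne j i with rfl | hj
  · simpa using ht
  · simpa [hj] using hx j

/-! ### Tight edges -/

/-- The edge `(i, j)` attains the maximum in the `i`-th equation of `A ⊗ x = μ x`. -/
def Tight {n : ℕ} (A : Matrix (Fin n) (Fin n) ℝ≥0) (μ : ℝ≥0) (x : Fin n → ℝ≥0)
    (i j : Fin n) : Prop :=
  A i j * x j = μ * x i

section

variable {n : ℕ} {A : Matrix (Fin n) (Fin n) ℝ≥0} {μ : ℝ≥0} {x y : Fin n → ℝ≥0}

theorem mul_le_of_mulVec_eq (h : mulVec A y = μ • x) (i j : Fin n) : A i j * y j ≤ μ * x i := by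
  have h2 := congrFun h i
  simp only [mulVec, Pi.smul_apply, smul_eq_mul] at h2
  rw [← h2]
  exact Finset.le_sup (f := fun j => A i j * y j) (Finset.mem_univ j)

theorem exists_mul_eq_of_mulVec_eq (h : mulVec A y = μ • x) (i : Fin n) :
    ∃ j, A i j * y j = μ * x i := by
  have h2 := congrFun h i
  simp only [mulVec, Pi.smul_apply, smul_eq_mul] at h2
  obtain ⟨j, -, hj⟩ := Finset.exists_mem_eq_sup Finset.univ ⟨i, Finset.mem_univ i⟩
    (fun j => A i j * y j)
  exact ⟨j, hj.symm.trans h2⟩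

theorem mulVec_eq_of_le_of_exists (h : ∀ i j, A i j * y j ≤ μ * x i)
    (h' : ∀ i, ∃ j, A i j * y j = μ * x i) : mulVec A y = μ • x := by
  funext i
  refine le_antisymm (Finset.sup_le fun j _ => h i j) ?_
  obtain ⟨j, hj⟩ := h' i
  simp only [Pi.smul_apply, smul_eq_mul, ← hj]
  exact Finset.le_sup (f := fun j => A i j * y j) (Finset.mem_univ j)

theorem mem_colSpan_deleteCol (hμ : 0 < μ) (h : mulVec A y = μ • x) {i : Fin n}
    (h' : ∀ a, ∃ l ≠ i, A a l * y l = μ * x a) : x ∈ colSpan (deleteCol A i) := by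
  refine ⟨fun j => y j.1 / μ, ?_⟩
  funext a
  refine le_antisymm ?_ (Finset.sup_le fun j _ => ?_)
  · obtain ⟨l, hl, hal⟩ := h' a
    refine le_trans (le_of_eq ?_)
      (Finset.le_sup (f := fun j => deleteCol A i a j * (y j.1 / μ)) (Finset.mem_univ ⟨l, hl⟩))
    simp only [deleteCol]
    rw [← mul_div_assoc, hal, mul_div_cancel_left₀ _ hμ.ne']
  · simp only [deleteCol]
    rw [← mul_div_assoc, div_le_iff₀ hμ, mul_comm (x a)]
    exact mul_le_of_mulVec_eq h a j

theorem mem_colSpan_deleteCol_of_lt (hμ : 0 < μ) (h : mulVec A y = μ • x) {i : Fin n}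
    (h' : ∀ a, A a i * y i < μ * x a) : x ∈ colSpan (deleteCol A i) :=
  mem_colSpan_deleteCol hμ h fun a =>
    let ⟨l, hl⟩ := exists_mul_eq_of_mulVec_eq h a
    ⟨l, fun e => (h' a).ne (e ▸ hl), hl⟩

theorem exists_of_mem_colSpan_deleteCol {i : Fin n} (h : x ∈ colSpan (deleteCol A i)) :
    ∃ y, y i = 0 ∧ mulVec A y = μ • x := by
  obtain ⟨c, hc⟩ := h
  refine ⟨fun j => if hj : j ≠ i then μ * c ⟨j, hj⟩ else 0, by simp, ?_⟩
  funext a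
  have hca : x a = Finset.univ.sup fun j => deleteCol A i a j * c j := congrFun hc a
  simp only [Pi.smul_apply, smul_eq_mul, hca, NNReal.mul_finset_sup, mulVec]
  refine le_antisymm (Finset.sup_le fun j _ => ?_) (Finset.sup_le fun j _ => ?_)
  · by_cases hj : j = i
    · simp [hj]
    · rw [dif_pos hj]
      refine le_trans (le_of_eq ?_) (Finset.le_sup
        (f := fun j => μ * (deleteCol A i a j * c j)) (Finset.mem_univ ⟨j, hj⟩))
      simp only [deleteCol]
      ring
  · refine le_trans (le_of_eq ?_) (Finset.le_sup (Finset.mem_univ j.1))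
    rw [dif_pos j.2]
    simp only [deleteCol]
    ring

theorem mul_lt_of_lt_of_le {a b c d : ℝ≥0} (hd : 0 < d) (h : b < c) (h' : a * c ≤ d) :
    a * b < d := by
  rcases eq_or_ne a 0 with rfl | ha
  · simpa using hd
  · exact (mul_lt_mul_of_pos_left h (pos_iff_ne_zero.2 ha)).trans_le h'

/-- If a positive eigenvector is spanned by the columns other than the `i`-th one, then some
column is never tight, or each row is tight outside of the `i`-th column. -/
theorem never_tight_or_of_mem_colSpan_deleteCol (hμ : 0 < μ) (hx : x ∈ eigencone A μ)
    (hpos : ∀ i, 0 < x i) {i : Fin n} (h : x ∈ colSpan (deleteCol A i)) :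
    (∃ l, ∀ a, ¬ Tight A μ x a l) ∨ ∀ a, ∃ l ≠ i, Tight A μ x a l := by
  obtain ⟨y, hyi, hy⟩ := exists_of_mem_colSpan_deleteCol (μ := μ) h
  -- A coordinate with `x l < y l` makes column `l` slack for `x`. If instead `y ≤ x`, edges
  -- attaining the maximum for `y` are tight for `x`, and they avoid `i` because `y i = 0`.
  by_cases hle : ∃ l, x l < y l
  · obtain ⟨l, hl⟩ := hle
    exact Or.inl ⟨l, fun a => (mul_lt_of_lt_of_le (mul_pos hμ (hpos a)) hl
      (mul_le_of_mulVec_eq hy a l)).ne⟩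
  · push Not at hle
    refine Or.inr fun a => ?_
    obtain ⟨l, hl⟩ := exists_mul_eq_of_mulVec_eq hy a
    refine ⟨l, ?_, le_antisymm (mul_le_of_mulVec_eq hx a l) ?_⟩
    · rintro rfl
      rw [hyi, mul_zero] at hl
      exact (mul_pos hμ (hpos a)).ne hl
    · rw [← hl]
      exact mul_le_mul_right (hle l) _

theorem hasSimpleImageEigencone_iff (hμ : 0 < μ) {X : Fin n → Set ℝ≥0} (hopen : LowerOpen X) :
    HasSimpleImageEigencone A μ (box X) ↔
      ∀ i : Fin n, colSpan (deleteCol A i) ∩ eigencone A μ ∩ box X = ∅ := by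
  constructor
  · intro hs i
    rw [Set.eq_empty_iff_forall_notMem]
    rintro x ⟨⟨hxs, hxV⟩, hxX⟩
    have hpos := pos_of_mem_box hopen hxX
    have hx0 : x ≠ 0 := fun e => (hpos i).ne' (congrFun e i)
    -- A dispensable coordinate can be lowered within the box without changing the image, against
    -- uniqueness.
    have key : ∀ l, (∀ a, ∃ j ≠ l, Tight A μ x a j) → False := by
      intro l hl
      obtain ⟨t, htx, ht⟩ := exists_update_mem_box hopen hxX l
      have := hs x hxV hx0 hxX _ ht (mulVec_eq_of_le_of_exists (fun a j => ?_) fun a => ?_)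
      · have h2 := congrFun this l
        simp only [Function.update_self] at h2
        exact htx.ne h2
      · refine le_trans (mul_le_mul_right ?_ _) (mul_le_of_mulVec_eq hxV a j)
        rcases eq_or_ne j l with rfl | hj
        · simpa using htx.le
        · simp [hj]
      · obtain ⟨j, hj, hja⟩ := hl a
        exact ⟨j, by rwa [Function.update_of_ne hj]⟩
    rcases never_tight_or_of_mem_colSpan_deleteCol hμ hxV hpos hxs with ⟨l, hl⟩ | hl
    · refine key l fun a => ?_
      obtain ⟨j, hj⟩ := exists_mul_eq_of_mulVec_eq hxV a
      exact ⟨j, fun e => hl a (e ▸ hj), hj⟩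
    · exact key i hl
  · intro h x hxV _ hxX y _ hy
    have hpos := pos_of_mem_box hopen hxX
    funext i
    by_contra hne
    refine Set.eq_empty_iff_forall_notMem.1 (h i) x ⟨⟨?_, hxV⟩, hxX⟩
    -- The solution with the smaller `i`-th entry supplies the coefficients.
    rcases lt_or_gt_of_ne hne with hlt | hlt
    · exact mem_colSpan_deleteCol_of_lt hμ hy fun a =>
        mul_lt_of_lt_of_le (mul_pos hμ (hpos a)) hlt (mul_le_of_mulVec_eq hxV a i)
    · exact mem_colSpan_deleteCol_of_lt hμ hxV fun a =>
        mul_lt_of_lt_of_le (mul_pos hμ (hpos a)) hlt (mul_le_of_mulVec_eq hy a i)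

/-- If no column can be spared, then the tight edges of a positive eigenvector form the graph of a
bijection. -/
theorem exists_bijective_tight_iff (hμ : 0 < μ) (hx : x ∈ eigencone A μ)
    (h : ∀ i, x ∉ colSpan (deleteCol A i)) :
    ∃ σ : Fin n → Fin n, Function.Bijective σ ∧ ∀ a b, Tight A μ x a b ↔ σ a = b := by
  -- Some row is tight only in column `i`; otherwise every row is tight elsewhere and column `i`
  -- could be spared.
  have h1 : ∀ i, ∃ a, ∀ l, Tight A μ x a l ↔ l = i := by
    intro i
    by_contra! hc
    refine h i (mem_colSpan_deleteCol hμ hx fun a => ?_)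
    by_contra! hc'
    obtain ⟨j, hj⟩ := exists_mul_eq_of_mulVec_eq hx a
    have hj' : ∀ l, Tight A μ x a l → l = i := fun l hl => by
      by_contra hne
      exact hc' l hne hl
    obtain ⟨l, hl⟩ := hc a
    rcases hl with ⟨hl, hli⟩ | ⟨hl, rfl⟩
    · exact hli (hj' l hl)
    · exact hl (hj' j hj ▸ hj)
  choose r hr using h1
  have hinj : Function.Injective r := fun i j hij => by
    rw [← hr j i, ← hij, hr]
  let e := Equiv.ofBijective r (Finite.injective_iff_bijective.1 hinj)
  refine ⟨e.symm, e.symm.bijective, fun a b => ?_⟩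
  obtain ⟨i, rfl⟩ := e.surjective a
  rw [e.symm_apply_apply]
  exact (hr i b).trans eq_comm

/-! ### Critical cycles -/

theorem maxSupport_eq_univ (hx : x ∈ eigencone A μ) (hpos : ∀ i, 0 < x i) :
    maxSupport A μ = Set.univ :=
  Set.eq_univ_of_forall fun i => ⟨x, hx, (hpos i).ne'⟩

theorem geomMean_eq_iff (c : NodeCycle n) :
    c.geomMean A = μ ↔ ∏ t : Fin (c.k + 1), A (c.node t) (c.node (t + 1)) = μ ^ (c.k + 1) := by
  have hk : ((c.k : ℝ) + 1) = ((c.k + 1 : ℕ) : ℝ) := by push_cast; rfl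
  unfold NodeCycle.geomMean
  rw [hk, one_div, NNReal.rpow_inv_eq_iff (by positivity), NNReal.rpow_natCast]

theorem prod_mul_node (c : NodeCycle n) :
    ∏ t : Fin (c.k + 1), A (c.node t) (c.node (t + 1)) * x (c.node (t + 1)) =
      (∏ t : Fin (c.k + 1), A (c.node t) (c.node (t + 1))) * ∏ t, x (c.node t) := by
  rw [Finset.prod_mul_distrib,
    Fintype.prod_equiv (Equiv.addRight (1 : Fin (c.k + 1))) (fun t => x (c.node (t + 1)))
      (fun t => x (c.node t)) fun _ => rfl]

/-- The critical cycles are the cycles of tight edges. -/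
theorem isCriticalCycle_iff (hμ : 0 < μ) (hx : x ∈ eigencone A μ) (hpos : ∀ i, 0 < x i)
    (c : NodeCycle n) : IsCriticalCycle A μ c ↔ ∀ i j, c.IsEdge i j → Tight A μ x i j := by
  have hP : (0 : ℝ≥0) < ∏ t, x (c.node t) := Finset.prod_pos fun t _ => hpos _
  have hprod : ∏ t : Fin (c.k + 1), μ * x (c.node t) = μ ^ (c.k + 1) * ∏ t, x (c.node t) := by
    rw [Finset.prod_mul_distrib, Finset.prod_const, Finset.card_univ, Fintype.card_fin]
  constructor
  · rintro ⟨-, hedge, hmean⟩ _ _ ⟨t, rfl, rfl⟩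
    rw [geomMean_eq_iff] at hmean
    by_contra hne
    -- One slack edge makes the product of the inequalities around the cycle strict. The entries of
    -- `x` contribute the same product to both sides, so the mean would fall below `μ`.
    have hlt := Finset.prod_lt_prod (s := Finset.univ)
      (f := fun t => A (c.node t) (c.node (t + 1)) * x (c.node (t + 1)))
      (g := fun t => μ * x (c.node t))
      (fun t _ => mul_pos (hedge _ _ ⟨t, rfl, rfl⟩) (hpos _))
      (fun t _ => mul_le_of_mulVec_eq hx _ _)
      ⟨t, Finset.mem_univ t, lt_of_le_of_ne (mul_le_of_mulVec_eq hx _ _) hne⟩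
    rw [prod_mul_node, hprod, hmean] at hlt
    exact hlt.false
  · intro h
    refine ⟨by simp [maxSupport_eq_univ hx hpos], fun i j hij => ?_, ?_⟩
    · have := h i j hij
      refine pos_iff_ne_zero.2 fun h0 => ?_
      rw [Tight, h0, zero_mul] at this
      exact (mul_pos hμ (hpos i)).ne this
    · rw [geomMean_eq_iff]
      refine mul_right_cancel₀ hP.ne' ?_
      rw [← prod_mul_node, ← hprod]
      exact Finset.prod_congr rfl fun t _ => h _ _ ⟨t, rfl, rfl⟩

theorem CritEdge.tight (hμ : 0 < μ) (hx : x ∈ eigencone A μ) (hpos : ∀ i, 0 < x i)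
    {i j : Fin n} (h : CritEdge A μ i j) : Tight A μ x i j :=
  let ⟨c, hc, hij⟩ := h
  (isCriticalCycle_iff hμ hx hpos c).1 hc i j hij

/-- The cycle through a periodic point of a self-map. -/
theorem exists_nodeCycle_of_mem_periodicPts (f : Fin n → Fin n) {i : Fin n}
    (hi : i ∈ Function.periodicPts f) :
    ∃ c : NodeCycle n, i ∈ c.nodes ∧ (∀ a ∈ c.nodes, ∃ m, f^[m] i = a) ∧
      ∀ a b, c.IsEdge a b ↔ a ∈ c.nodes ∧ f a = b := by
  have hp := Function.minimalPeriod_pos_of_mem_periodicPts hi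
  obtain ⟨k, hk⟩ : ∃ k, Function.minimalPeriod f i = k + 1 := ⟨_, (Nat.succ_pred_eq_of_pos hp).symm⟩
  let c : NodeCycle n := ⟨k, fun t => f^[t.1] i, fun s t hst => Fin.ext
    ((Function.iterate_eq_iterate_iff_of_lt_minimalPeriod (by omega) (by omega)).1 hst)⟩
  have hstep : ∀ t : Fin (k + 1), f (c.node t) = c.node (t + 1) := by
    intro t
    change f (f^[t.1] i) = f^[(t + 1).1] i
    rw [← Function.iterate_succ_apply' f, Fin.val_add_one]
    split_ifs with ht
    · rw [ht, Fin.val_last, Nat.succ_eq_add_one, ← hk, Function.iterate_minimalPeriod]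
      rfl
    · rfl
  refine ⟨c, ⟨0, rfl⟩, ?_, fun a b => ⟨?_, ?_⟩⟩
  · rintro _ ⟨t, rfl⟩
    exact ⟨t.1, rfl⟩
  · rintro ⟨t, rfl, rfl⟩
    exact ⟨⟨t, rfl⟩, hstep t⟩
  · rintro ⟨⟨t, rfl⟩, rfl⟩
    exact ⟨t, rfl, (hstep t).symm⟩

/-- Choosing one tight edge out of each node gives a self-map, whose periodic orbits are cycles of
tight edges, hence critical. -/
theorem critEdge_of_mem_periodicPts (hμ : 0 < μ) (hx : x ∈ eigencone A μ) (hpos : ∀ i, 0 < x i)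
    (f : Fin n → Fin n) (hf : ∀ i, Tight A μ x i (f i)) {i : Fin n}
    (hi : i ∈ Function.periodicPts f) : CritEdge A μ i (f i) := by
  obtain ⟨c, hic, -, hedge⟩ := exists_nodeCycle_of_mem_periodicPts f hi
  refine ⟨c, (isCriticalCycle_iff hμ hx hpos c).2 fun a b hab => ?_, (hedge _ _).2 ⟨hic, rfl⟩⟩
  obtain ⟨-, rfl⟩ := (hedge _ _).1 hab
  exact hf a

theorem NodeCycle.IsEdge.left_mem {c : NodeCycle n} {i j : Fin n} (h : c.IsEdge i j) :
    i ∈ c.nodes :=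
  let ⟨t, ht, _⟩ := h
  ⟨t, ht⟩

theorem mem_critNodes_iff {i : Fin n} : i ∈ critNodes A μ ↔ ∃ j, CritEdge A μ i j := by
  constructor
  · rintro ⟨c, hc, t, rfl⟩
    exact ⟨_, c, hc, t, rfl, rfl⟩
  · rintro ⟨j, c, hc, hij⟩
    exact ⟨c, hc, hij.left_mem⟩

theorem exists_critEdge_of_mem_critNodes {j : Fin n} (h : j ∈ critNodes A μ) :
    ∃ i, CritEdge A μ i j := by
  obtain ⟨c, hc, t, rfl⟩ := h
  exact ⟨_, c, hc, t - 1, rfl, by rw [sub_add_cancel]⟩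

/-! ### Strongly connected components of the critical graph -/

theorem SameCritComponent.refl (i : Fin n) : SameCritComponent A μ i i :=
  ⟨.refl, .refl⟩

theorem SameCritComponent.symm {i j : Fin n} (h : SameCritComponent A μ i j) :
    SameCritComponent A μ j i :=
  ⟨h.2, h.1⟩

theorem SameCritComponent.trans {i j k : Fin n} (h : SameCritComponent A μ i j)
    (h' : SameCritComponent A μ j k) : SameCritComponent A μ i k :=
  ⟨h.1.trans h'.1, h'.2.trans h.2⟩

theorem mem_critReps_iff {j : Fin n} :
    j ∈ critReps A μ ↔ j ∈ critNodes A μ ∧ ∀ i, SameCritComponent A μ i j → j ≤ i := by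
  simp [critReps]

theorem critReps_eq_of_sameCritComponent {s t : critReps A μ}
    (h : SameCritComponent A μ s.1 t.1) : s = t :=
  Subtype.ext (le_antisymm ((mem_critReps_iff.1 s.2).2 _ h.symm)
    ((mem_critReps_iff.1 t.2).2 _ h))

theorem SameCritComponent.mem_critNodes {i j : Fin n} (h : SameCritComponent A μ i j)
    (hj : j ∈ critNodes A μ) : i ∈ critNodes A μ := by
  rcases h.1.cases_head with rfl | ⟨k, hk, -⟩
  · exact hj
  · exact mem_critNodes_iff.2 ⟨k, hk⟩

theorem exists_critReps_sameCritComponent {i : Fin n} (hi : i ∈ critNodes A μ) :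
    ∃ s : critReps A μ, SameCritComponent A μ i s.1 := by
  classical
  obtain ⟨j, hj, hmin⟩ := Finset.exists_min_image
    (Finset.univ.filter fun j => SameCritComponent A μ j i) id
    ⟨i, Finset.mem_filter.2 ⟨Finset.mem_univ i, .refl i⟩⟩
  have hj := (Finset.mem_filter.1 hj).2
  refine ⟨⟨j, mem_critReps_iff.2 ⟨hj.mem_critNodes hi, fun l hl => ?_⟩⟩, hj.symm⟩
  exact hmin l (Finset.mem_filter.2 ⟨Finset.mem_univ l, hl.trans hj⟩)

theorem reflTransGen_iff_exists_iterate {σ : Fin n → Fin n}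
    (hσ : ∀ a b, CritEdge A μ a b ↔ σ a = b) {i j : Fin n} :
    Relation.ReflTransGen (CritEdge A μ) i j ↔ ∃ m, σ^[m] i = j := by
  constructor
  · intro h
    induction h with
    | refl => exact ⟨0, rfl⟩
    | tail _ hbc ih =>
      obtain ⟨m, rfl⟩ := ih
      exact ⟨m + 1, by rw [Function.iterate_succ_apply', (hσ _ _).1 hbc]⟩
  · rintro ⟨m, rfl⟩
    induction m with
    | zero => exact .refl
    | succ m ih => exact ih.tail ((hσ _ _).2 (Function.iterate_succ_apply' _ _ _).symm)

theorem sameCritComponent_iff_exists_iterate {σ : Fin n → Fin n}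
    (hσ : ∀ a b, CritEdge A μ a b ↔ σ a = b) (hinj : Function.Injective σ) {i j : Fin n} :
    SameCritComponent A μ i j ↔ ∃ m, σ^[m] i = j := by
  rw [← reflTransGen_iff_exists_iterate hσ]
  refine ⟨fun h => h.1, fun h => ⟨h, ?_⟩⟩
  obtain ⟨m, rfl⟩ := (reflTransGen_iff_exists_iterate hσ).1 h
  refine (reflTransGen_iff_exists_iterate hσ).2 ?_
  obtain ⟨p, hp, hper⟩ := hinj.mem_periodicPts i
  -- With `p` a period of `i`, these further steps complete `m * p` steps and return to `i`.
  refine ⟨m * p - m, ?_⟩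
  rw [← Function.iterate_add_apply, Nat.sub_add_cancel (Nat.le_mul_of_pos_right m hp)]
  exact hper.const_mul m

theorem critEdge_iff_of_tight_iff (hμ : 0 < μ) (hx : x ∈ eigencone A μ) (hpos : ∀ i, 0 < x i)
    {σ : Fin n → Fin n} (hinj : Function.Injective σ) (hσ : ∀ a b, Tight A μ x a b ↔ σ a = b)
    (a b : Fin n) : CritEdge A μ a b ↔ σ a = b := by
  refine ⟨fun h => (hσ a b).1 (h.tight hμ hx hpos), ?_⟩
  rintro rfl
  exact critEdge_of_mem_periodicPts hμ hx hpos σ (fun i => (hσ _ _).2 rfl)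
    (hinj.mem_periodicPts a)

theorem critIsDisjointCycles_of_critEdge_iff {σ : Fin n → Fin n} (hinj : Function.Injective σ)
    (hσ : ∀ a b, CritEdge A μ a b ↔ σ a = b) :
    critNodes A μ = Set.univ ∧ CritIsDisjointCycles A μ := by
  have huniv : critNodes A μ = Set.univ :=
    Set.eq_univ_of_forall fun i => mem_critNodes_iff.2 ⟨_, (hσ _ _).2 rfl⟩
  choose c hc1 hc2 hc3 using fun i =>
    exists_nodeCycle_of_mem_periodicPts σ (hinj.mem_periodicPts i)
  have hiter : ∀ i m, σ^[m] i ∈ (c i).nodes := by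
    intro i m
    induction m with
    | zero => exact hc1 i
    | succ m ih =>
      obtain ⟨t, -, ht⟩ := (hc3 i _ _).2 ⟨ih, rfl⟩
      rw [Function.iterate_succ_apply']
      exact ⟨_, ht⟩
  have hmem : ∀ i j, j ∈ (c i).nodes ↔ SameCritComponent A μ i j := by
    intro i j
    rw [sameCritComponent_iff_exists_iterate hσ hinj]
    refine ⟨hc2 i j, ?_⟩
    rintro ⟨m, rfl⟩
    exact hiter i m
  refine ⟨huniv, fun s => c s.1, fun s => hc1 _, fun s t hst => ?_, fun i => ?_, fun i j => ?_⟩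
  · refine Set.disjoint_left.2 fun i hs ht => hst ?_
    exact critReps_eq_of_sameCritComponent (((hmem _ _).1 hs).trans ((hmem _ _).1 ht).symm)
  · simp only [huniv, Set.mem_univ, true_iff, hmem]
    obtain ⟨s, hs⟩ := exists_critReps_sameCritComponent (huniv ▸ Set.mem_univ i)
    exact ⟨s, hs.symm⟩
  · rw [hσ]
    constructor
    · rintro rfl
      obtain ⟨s, hs⟩ := exists_critReps_sameCritComponent (huniv ▸ Set.mem_univ i)
      exact ⟨s, (hc3 _ _ _).2 ⟨(hmem _ _).2 hs.symm, rfl⟩⟩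
    · rintro ⟨s, hs⟩
      exact ((hc3 _ _ _).1 hs).2

theorem CritIsDisjointCycles.exists_critEdge_iff (huniv : critNodes A μ = Set.univ)
    (h : CritIsDisjointCycles A μ) :
    ∃ σ : Fin n → Fin n, Function.Injective σ ∧ ∀ a b, CritEdge A μ a b ↔ σ a = b := by
  obtain ⟨c, -, hdisj, -, hedge⟩ := h
  have hex : ∀ a, ∃ b, CritEdge A μ a b := fun a =>
    mem_critNodes_iff.1 (huniv ▸ Set.mem_univ a)
  choose σ hσ using hex
  have huniq : ∀ a b, CritEdge A μ a b ↔ σ a = b := by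
    refine fun a b => ⟨fun hab => ?_, fun e => e ▸ hσ a⟩
    obtain ⟨s, p, hp, hp'⟩ := (hedge _ _).1 hab
    obtain ⟨t, q, hq, hq'⟩ := (hedge _ _).1 (hσ a)
    -- Both edges leave `a`, and disjoint cycles cannot share a node.
    have hst : s = t := by
      by_contra hne
      exact Set.disjoint_left.1 (hdisj s t hne) ⟨p, hp⟩ ⟨q, hq⟩
    subst hst
    rw [← hp', ← hq', (c s).node_injective (hp.trans hq.symm)]
  refine ⟨σ, Finite.injective_iff_surjective.2 fun b => ?_, huniq⟩
  obtain ⟨a, ha⟩ := exists_critEdge_of_mem_critNodes (huniv ▸ Set.mem_univ b)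
  exact ⟨a, (huniq a b).1 ha⟩

/-- A tight edge inside of a strongly connected component of the critical graph is critical. -/
theorem critEdge_of_tight_of_sameCritComponent (hμ : 0 < μ) (hx : x ∈ eigencone A μ)
    (hpos : ∀ i, 0 < x i) {σ : Fin n → Fin n} (hσ : ∀ a b, CritEdge A μ a b ↔ σ a = b)
    {j l : Fin n} (hjl : Tight A μ x j l) (h : SameCritComponent A μ l j) :
    CritEdge A μ j l := by
  classical
  have hex := (reflTransGen_iff_exists_iterate hσ).1 h.1
  -- Redirect `σ` at `j` along the given edge. Up to the first visit of the `σ`-orbit of `l` to `j`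
  -- the two maps agree, so `j` becomes periodic.
  let f := Function.update σ j l
  have hf : ∀ m ≤ Nat.find hex, f^[m] l = σ^[m] l := by
    intro m
    induction m with
    | zero => exact fun _ => rfl
    | succ m ih =>
      intro hm
      rw [Function.iterate_succ_apply', Function.iterate_succ_apply', ih (by omega)]
      exact Function.update_of_ne (Nat.find_min hex (by omega)) _ _
  have hfj : f j = l := Function.update_self ..
  have hper : j ∈ Function.periodicPts f := by
    refine ⟨Nat.find hex + 1, Nat.succ_pos _, ?_⟩
    rw [Function.IsPeriodicPt, Function.IsFixedPt, Function.iterate_succ_apply, hfj, hf _ le_rfl]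
    exact Nat.find_spec hex
  rw [← hfj]
  refine critEdge_of_mem_periodicPts hμ hx hpos f (fun i => ?_) hper
  rcases eq_or_ne i j with rfl | hij
  · rwa [hfj]
  · rw [show f i = σ i from Function.update_of_ne hij _ _]
    exact ((hσ _ _).2 rfl).tight hμ hx hpos

/-! ### The generating matrix -/

/-- The subeigenvector inequality iterates along paths. Zero entries of `z` are allowed. -/
theorem plus_mul_le (hμ : 0 < μ) {z : Fin n → ℝ≥0} (hz : ∀ i j, A i j * z j ≤ μ * z i)
    (i j : Fin n) : plus (normalized A μ) i j * z j ≤ z i := by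
  have hstep : ∀ i l, normalized A μ i l * z l ≤ z i := by
    intro i l
    unfold normalized
    split_ifs with hl
    · rw [div_mul_eq_mul_div, div_le_iff₀ hμ, mul_comm (z i)]
      exact hz i l
    · simp
  have hpow : ∀ k i, powSucc (normalized A μ) k i j * z j ≤ z i := by
    intro k
    induction k with
    | zero => exact fun i => hstep i j
    | succ k ih =>
      intro i
      simp only [powSucc, mul, NNReal.finset_sup_mul]
      refine Finset.sup_le fun l _ => ?_
      rw [mul_assoc]
      exact (mul_le_mul_right (ih l) _).trans (hstep i l)
  rw [plus, NNReal.iSup_mul]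
  exact ciSup_le fun k => hpow k i

theorem normalized_eq (hx : x ∈ eigencone A μ) (hpos : ∀ i, 0 < x i) (i j : Fin n) :
    normalized A μ i j = A i j / μ := by
  simp [normalized, maxSupport_eq_univ hx hpos]

/-- Along a tight path the normalized weights telescope to the ratio of the end values of `x`. -/
theorem le_plus_mul_of_transGen (hμ : 0 < μ) (hx : x ∈ eigencone A μ) (hpos : ∀ i, 0 < x i)
    {i j : Fin n} (h : Relation.TransGen (Tight A μ x) i j) :
    x i ≤ plus (normalized A μ) i j * x j := by
  have hstep : ∀ {a b}, Tight A μ x a b → normalized A μ a b * x b = x a := by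
    intro a b hab
    rw [normalized_eq hx hpos, div_mul_eq_mul_div, hab, mul_div_cancel_left₀ _ hμ.ne']
  obtain ⟨k, hk⟩ : ∃ k, x i ≤ powSucc (normalized A μ) k i j * x j := by
    induction h using Relation.TransGen.head_induction_on with
    | single h => exact ⟨0, (hstep h).ge⟩
    | head h _ ih =>
      obtain ⟨k, hk⟩ := ih
      refine ⟨k + 1, ?_⟩
      rw [← hstep h]
      refine (mul_le_mul_right hk _).trans ?_
      rw [← mul_assoc]
      exact mul_le_mul_left (Finset.le_sup
        (f := fun l => normalized A μ _ l * powSucc (normalized A μ) k l j) (Finset.mem_univ _)) _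
  exact hk.trans (mul_le_mul_left (le_ciSup (bddAbove_powSucc_normalized A hμ i j) k) _)

/-- Multiplying the series by the normalized matrix loses only its first power; the diagonal
condition recovers that term. -/
theorem plus_col_mem_eigencone (hμ : 0 < μ) (hx : x ∈ eigencone A μ) (hpos : ∀ i, 0 < x i)
    {j : Fin n} (hj : 1 ≤ plus (normalized A μ) j j) :
    (fun i => plus (normalized A μ) i j) ∈ eigencone A μ := by
  have hB : ∀ i l, A i l = μ * normalized A μ i l := by
    intro i l
    rw [normalized_eq hx hpos, mul_div_cancel₀ _ hμ.ne']
  have hbdd := fun i => bddAbove_powSucc_normalized A hμ i j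
  funext i
  simp only [mulVec, Pi.smul_apply, smul_eq_mul]
  apply le_antisymm
  · refine Finset.sup_le fun l _ => ?_
    rw [hB, mul_assoc]
    refine mul_le_mul_right ?_ _
    conv_lhs => rw [plus, NNReal.mul_iSup]
    refine ciSup_le fun k => le_trans ?_ (le_ciSup (hbdd i) (k + 1))
    exact Finset.le_sup
      (f := fun l => normalized A μ i l * powSucc (normalized A μ) k l j) (Finset.mem_univ _)
  · conv_lhs => rw [plus, NNReal.mul_iSup]
    refine ciSup_le fun k => ?_
    cases k with
    | zero =>
      refine le_trans ?_ (Finset.le_sup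
        (f := fun l => A i l * plus (normalized A μ) l j) (Finset.mem_univ j))
      rw [powSucc, ← hB]
      exact le_mul_of_one_le_right zero_le hj
    | succ k =>
      simp only [powSucc, mul, NNReal.mul_finset_sup]
      refine Finset.sup_mono_fun fun l _ => ?_
      rw [← mul_assoc, ← hB]
      exact mul_le_mul_right (le_ciSup (hbdd l) k) _

theorem mulVec_mem_eigencone {ι : Type*} [Fintype ι] {G : Matrix (Fin n) ι ℝ≥0}
    (hG : ∀ s, (fun i => G i s) ∈ eigencone A μ) (c : ι → ℝ≥0) : mulVec G c ∈ eigencone A μ := by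
  have h : mulVec G c = Finset.univ.sup fun s i => G i s * c s := by
    funext i
    simp [mulVec, Finset.sup_apply]
  rw [h]
  refine Finset.sup_induction (p := fun x => x ∈ eigencone A μ) (zero_mem_eigencone A μ)
    (fun _ h1 _ h2 => sup_mem_eigencone h1 h2) fun s _ => ?_
  funext i
  have h1 := congrFun (hG s) i
  simp only [mulVec, Pi.smul_apply, smul_eq_mul] at h1 ⊢
  rw [← mul_assoc, ← h1, NNReal.finset_sup_mul]
  simp only [mul_assoc]

theorem SameCritComponent.transGen_tight (hμ : 0 < μ) (hx : x ∈ eigencone A μ) (hpos : ∀ i, 0 < x i)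
    {σ : Fin n → Fin n} (hσ : ∀ a b, CritEdge A μ a b ↔ σ a = b) (hinj : Function.Injective σ)
    {i j : Fin n} (h : SameCritComponent A μ i j) : Relation.TransGen (Tight A μ x) i j := by
  have h1 : SameCritComponent A μ (σ i) j :=
    ((sameCritComponent_iff_exists_iterate hσ hinj).2 ⟨1, rfl⟩ :
      SameCritComponent A μ i (σ i)).symm.trans h
  exact .head' (((hσ i _).2 rfl).tight hμ hx hpos)
    (Relation.ReflTransGen.mono (fun a b hab => CritEdge.tight hμ hx hpos hab) _ _ h1.1)

/-- Under (1) no tight edge of an eigenvector in the box leaves the component of `s`. Shrinking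
there by the largest ratio on a leaving edge preserves the subeigenvector inequality. Generators of
other components see unchanged values at their representatives, so they span at most the shrunk
value at `s`. -/
theorem colSpan_deleteCol_generating_eq_empty (hμ : 0 < μ) {X : Fin n → Set ℝ≥0}
    (hopen : LowerOpen X) (hne : (eigencone A μ ∩ box X).Nonempty)
    (h : ∀ i : Fin n, colSpan (deleteCol A i) ∩ eigencone A μ ∩ box X = ∅)
    (s : critReps A μ) : colSpan (deleteCol (generating A μ) s) ∩ box X = ∅ := by
  classical
  have hσex : ∀ x ∈ eigencone A μ ∩ box X, ∃ σ : Fin n → Fin n, Function.Injective σ ∧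
      (∀ a b, Tight A μ x a b ↔ σ a = b) ∧ ∀ a b, CritEdge A μ a b ↔ σ a = b := by
    rintro x ⟨hxV, hxX⟩
    have hpos := pos_of_mem_box hopen hxX
    obtain ⟨σ, hbij, hσ⟩ := exists_bijective_tight_iff hμ hxV fun i hi =>
      Set.eq_empty_iff_forall_notMem.1 (h i) x ⟨⟨hi, hxV⟩, hxX⟩
    exact ⟨σ, hbij.1, hσ, critEdge_iff_of_tight_iff hμ hxV hpos hbij.1 hσ⟩
  -- Every node lies on a tight cycle, whose normalized weight is one.
  have hdiag : ∀ j : Fin n, 1 ≤ plus (normalized A μ) j j := by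
    intro j
    obtain ⟨w, hwV, hwX⟩ := hne
    have hw := pos_of_mem_box hopen hwX
    obtain ⟨τ, hτ, -, hτc⟩ := hσex w ⟨hwV, hwX⟩
    have h1 := le_plus_mul_of_transGen hμ hwV hw (SameCritComponent.transGen_tight hμ hwV hw hτc hτ (.refl j))
    exact le_of_mul_le_mul_right (by simpa using h1) (hw j)
  rw [Set.eq_empty_iff_forall_notMem]
  rintro x ⟨⟨c, hc⟩, hxX⟩
  have hxV : x ∈ eigencone A μ := by
    obtain ⟨w, hwV, hwX⟩ := hne
    rw [hc]
    exact mulVec_mem_eigencone (fun t =>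
      plus_col_mem_eigencone hμ hwV (pos_of_mem_box hopen hwX) (hdiag t.1.1)) c
  have hpos := pos_of_mem_box hopen hxX
  obtain ⟨σ, hinj, hσ, hσc⟩ := hσex x ⟨hxV, hxX⟩
  let S : Fin n → Prop := fun i => SameCritComponent A μ s.1 i
  -- The ratio bounding the edges that leave the component of `s`.
  let β : ℝ≥0 := Finset.univ.sup fun p : Fin n × Fin n =>
    if S p.1 ∧ ¬ S p.2 then A p.1 p.2 * x p.2 / (μ * x p.1) else 0
  have hβ1 : β < 1 := by
    refine (Finset.sup_lt_iff (by simp)).2 fun p _ => ?_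
    split_ifs with hp
    · rw [div_lt_one (mul_pos hμ (hpos _))]
      refine lt_of_le_of_ne (mul_le_of_mulVec_eq hxV _ _) fun e => hp.2 ?_
      refine hp.1.trans ((sameCritComponent_iff_exists_iterate hσc hinj).2 ⟨1, (hσ _ _).1 e⟩)
    · exact one_pos
  have hβ : ∀ i j, S i → ¬ S j → A i j * x j ≤ μ * (β * x i) := by
    intro i j hi hj
    have h1 := Finset.le_sup (f := fun p : Fin n × Fin n =>
      if S p.1 ∧ ¬ S p.2 then A p.1 p.2 * x p.2 / (μ * x p.1) else 0) (Finset.mem_univ (i, j))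
    simp only [hi, hj, not_false_eq_true, and_self, if_true] at h1
    rw [div_le_iff₀ (mul_pos hμ (hpos _))] at h1
    exact h1.trans_eq (by ring)
  let z : Fin n → ℝ≥0 := fun i => if S i then β * x i else x i
  have hzx : ∀ i, z i ≤ x i := by
    intro i
    simp only [z]
    split_ifs
    · exact mul_le_of_le_one_left zero_le hβ1.le
    · exact le_rfl
  have hz : ∀ i j, A i j * z j ≤ μ * z i := by
    intro i j
    by_cases hi : S i
    · rw [show z i = β * x i from if_pos hi]
      by_cases hj : S j
      · rw [show z j = β * x j from if_pos hj, mul_left_comm, mul_left_comm μ]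
        exact mul_le_mul_right (mul_le_of_mulVec_eq hxV i j) _
      · rw [show z j = x j from if_neg hj]
        exact hβ i j hi hj
    · rw [show z i = x i from if_neg hi]
      exact (mul_le_mul_right (hzx j) _).trans (mul_le_of_mulVec_eq hxV i j)
  have hlt : z s.1 < x s.1 := by
    rw [show z s.1 = β * x s.1 from if_pos (.refl _)]
    exact mul_lt_of_lt_one_left (hpos _) hβ1
  have hcx : ∀ t i, plus (normalized A μ) i t.1.1 * c t ≤ x i := by
    intro t i
    rw [hc]
    exact Finset.le_sup (f := fun t => deleteCol (generating A μ) s i t * c t) (Finset.mem_univ t)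
  refine hlt.not_ge ?_
  conv_lhs => rw [hc]
  refine Finset.sup_le fun t _ => ?_
  have ht : ¬ S t.1.1 := fun e => t.2 (critReps_eq_of_sameCritComponent e).symm
  calc plus (normalized A μ) s.1 t.1.1 * c t
      ≤ plus (normalized A μ) s.1 t.1.1 * z t.1.1 := by
        rw [show z t.1.1 = x t.1.1 from if_neg ht]
        refine mul_le_mul_right (le_trans ?_ (hcx t t.1.1)) _
        exact le_mul_of_one_le_left zero_le (hdiag _)
    _ ≤ z s.1 := plus_mul_le hμ hz _ _

/-- The critical edge into `i` starts at a row `j` that has another tight edge, and this one leads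
to a different component. Hence every node has a tight path to a representative other than that of
`j`. -/
theorem exists_mem_colSpan_deleteCol_generating (hμ : 0 < μ) (hx : x ∈ eigencone A μ)
    (hpos : ∀ i, 0 < x i) (huniv : critNodes A μ = Set.univ) (hcyc : CritIsDisjointCycles A μ)
    {i : Fin n} (hi : x ∈ colSpan (deleteCol A i)) :
    ∃ s, x ∈ colSpan (deleteCol (generating A μ) s) := by
  obtain ⟨σ, hinj, hσ⟩ := hcyc.exists_critEdge_iff huniv
  have hsurj := Finite.injective_iff_surjective.1 hinj
  have hrep : ∀ a, ∃ s : critReps A μ, SameCritComponent A μ a s.1 := fun a =>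
    exists_critReps_sameCritComponent (huniv ▸ Set.mem_univ a)
  have hrow : ∀ a, ∃ l ≠ i, Tight A μ x a l := by
    refine (never_tight_or_of_mem_colSpan_deleteCol hμ hx hpos hi).resolve_left ?_
    rintro ⟨l, hl⟩
    obtain ⟨a, rfl⟩ := hsurj l
    exact hl a (((hσ a _).2 rfl).tight hμ hx hpos)
  obtain ⟨j, hj⟩ := hsurj i
  obtain ⟨l, hli, hjl⟩ := hrow j
  obtain ⟨s, hs⟩ := hrep j
  obtain ⟨t, ht⟩ := hrep l
  have hts : t ≠ s := by
    rintro rfl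
    have := critEdge_of_tight_of_sameCritComponent hμ hx hpos hσ hjl (ht.trans hs.symm)
    exact hli (((hσ _ _).1 this).symm.trans hj)
  refine ⟨s, fun r => x r.1.1, ?_⟩
  funext a
  refine le_antisymm ?_ (Finset.sup_le fun r _ =>
    plus_mul_le hμ (fun i j => mul_le_of_mulVec_eq hx i j) a r.1.1)
  have hle : ∀ r : {r // r ≠ s}, Relation.TransGen (Tight A μ x) a r.1.1 →
      x a ≤ mulVec (deleteCol (generating A μ) s) (fun r => x r.1.1) a := fun r hr =>
    (le_plus_mul_of_transGen hμ hx hpos hr).trans (Finset.le_sup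
      (f := fun r : {r // r ≠ s} => deleteCol (generating A μ) s a r * x r.1.1)
      (Finset.mem_univ r))
  obtain ⟨r, hr⟩ := hrep a
  by_cases hrs : r = s
  · subst hrs
    refine hle ⟨t, hts⟩ ?_
    exact (SameCritComponent.transGen_tight hμ hx hpos hσ hinj (hr.trans hs.symm)).trans
      ((Relation.TransGen.single hjl).trans (SameCritComponent.transGen_tight hμ hx hpos hσ hinj ht))
  · exact hle ⟨r, hrs⟩ (SameCritComponent.transGen_tight hμ hx hpos hσ hinj hr)

/-- The projection dominates every spanned vector of the box. If it exceeds the lower corner, it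
lies in the box by convexity of the intervals. -/
theorem colSpan_inter_box_eq_empty_iff {ι : Type*} [Fintype ι] (G : Matrix (Fin n) ι ℝ≥0)
    {X : Fin n → Set ℝ≥0} (hX : ∀ i, (X i).OrdConnected) (hopen : LowerOpen X)
    (hup : UpperClosed X) :
    colSpan G ∩ box X = ∅ ↔ ¬ ∀ i, lower X i < proj (colSpan G) (upper X) i := by
  have hP := isGreatest_proj_colSpan G (upper X)
  rw [Set.eq_empty_iff_forall_notMem, ← not_exists, not_iff_not]
  constructor
  · rintro ⟨y, hy, hyX⟩ i
    exact (lower_lt hopen hyX i).trans_le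
      (hP.2 ⟨hy, fun i => le_csSup (hup.1 i) (hyX i)⟩ i)
  · intro h
    refine ⟨_, hP.1.1, fun i => ?_⟩
    obtain ⟨t, ht, hti⟩ := exists_lt_of_csInf_lt ⟨_, hup.2 i⟩ (h i)
    exact (hX i).out ht (hup.2 i) ⟨hti.le, hP.1.2 i⟩

end

end MaxAlg

theorem theoremt {n : ℕ} (A : Matrix (Fin n) (Fin n) ℝ≥0) (μ : ℝ≥0) (hμ : 0 < μ)
    (X : Fin n → Set ℝ≥0) (hX : ∀ i, (X i).OrdConnected) (hopen : MaxAlg.LowerOpen X)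
    (hne : (MaxAlg.eigencone A μ ∩ MaxAlg.box X).Nonempty) :
    (MaxAlg.HasSimpleImageEigencone A μ (MaxAlg.box X) ↔
      ∀ i : Fin n, MaxAlg.colSpan (MaxAlg.deleteCol A i) ∩ MaxAlg.eigencone A μ
        ∩ MaxAlg.box X = ∅) ∧
    ((∀ i : Fin n, MaxAlg.colSpan (MaxAlg.deleteCol A i) ∩ MaxAlg.eigencone A μ
        ∩ MaxAlg.box X = ∅) →
      MaxAlg.critNodes A μ = Set.univ ∧ MaxAlg.CritIsDisjointCycles A μ) ∧
    (MaxAlg.critNodes A μ = Set.univ → MaxAlg.CritIsDisjointCycles A μ →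
      ((∀ i : Fin n, MaxAlg.colSpan (MaxAlg.deleteCol A i) ∩ MaxAlg.eigencone A μ
          ∩ MaxAlg.box X = ∅) ↔
        ∀ s : MaxAlg.critReps A μ,
          MaxAlg.colSpan (MaxAlg.deleteCol (MaxAlg.generating A μ) s) ∩ MaxAlg.box X = ∅)) ∧
    (MaxAlg.critNodes A μ = Set.univ → MaxAlg.CritIsDisjointCycles A μ →
      MaxAlg.UpperClosed X →
      ((∀ i : Fin n, MaxAlg.colSpan (MaxAlg.deleteCol A i) ∩ MaxAlg.eigencone A μ
          ∩ MaxAlg.box X = ∅) ↔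
        ∀ s : MaxAlg.critReps A μ, ¬ ∀ i : Fin n, MaxAlg.lower X i <
          MaxAlg.proj (MaxAlg.colSpan (MaxAlg.deleteCol (MaxAlg.generating A μ) s))
            (MaxAlg.upper X) i)) := by
  have hiii : MaxAlg.critNodes A μ = Set.univ → MaxAlg.CritIsDisjointCycles A μ →
      ((∀ i : Fin n, MaxAlg.colSpan (MaxAlg.deleteCol A i) ∩ MaxAlg.eigencone A μ
          ∩ MaxAlg.box X = ∅) ↔
        ∀ s : MaxAlg.critReps A μ,
          MaxAlg.colSpan (MaxAlg.deleteCol (MaxAlg.generating A μ) s) ∩ MaxAlg.box X = ∅) := by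
    refine fun huniv hcyc =>
      ⟨MaxAlg.colSpan_deleteCol_generating_eq_empty hμ hopen hne, fun h i => ?_⟩
    rw [Set.eq_empty_iff_forall_notMem]
    rintro x ⟨⟨hxs, hxV⟩, hxX⟩
    obtain ⟨s, hs⟩ := MaxAlg.exists_mem_colSpan_deleteCol_generating hμ hxV
      (MaxAlg.pos_of_mem_box hopen hxX) huniv hcyc hxs
    exact Set.eq_empty_iff_forall_notMem.1 (h s) x ⟨hs, hxX⟩
  refine ⟨MaxAlg.hasSimpleImageEigencone_iff hμ hopen, fun h => ?_, hiii,
    fun huniv hcyc hup => (hiii huniv hcyc).trans (forall_congr' fun s =>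
      MaxAlg.colSpan_inter_box_eq_empty_iff _ hX hopen hup)⟩
  obtain ⟨x, hxV, hxX⟩ := hne
  obtain ⟨σ, hσ, hT⟩ := MaxAlg.exists_bijective_tight_iff hμ hxV fun i hi =>
    Set.eq_empty_iff_forall_notMem.1 (h i) x ⟨⟨hi, hxV⟩, hxX⟩
  exact MaxAlg.critIsDisjointCycles_of_critEdge_iff hσ.1
    (MaxAlg.critEdge_iff_of_tight_iff hμ hxV (MaxAlg.pos_of_mem_box hopen hxX) hσ.1 hT)
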